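/- Let $f:\mathbb{R}^{n}\times\mathbb{R}^{p}\to\mathbb{R}^{n}$ be $C^\infty$, let $R:\mathbb{R}^{n}\to\mathbb{R}^{m}$ be a surjective linear map, and let $x_0\in\mathbb{R}^n$, $y\in\mathbb{R}^m$. Let $\mathcal V=L^\infty([0,1],\mathbb{R}^p)$. For $u\in\mathcal V$ let $t\mapsto\varphi_t(u,x_0)$ denote the (Carathéodory) solution of $\dot x(t)=f(x(t),u(t))$, $x(0)=x_0$, and let $$U(x_0,y)=\{u\in\mathcal V : \varphi_t(u,x_0)\text{ exists for all } t\in[0,1] \text{ and } R(\varphi_1(u,x_0))=y\}.$$ Assume the linearized controllability property at $x_0$: for every $u\in U(x_0,y)$, with $x(t)=\varphi_t(u,x_0)$, the linear time-varying system $$\dot z(t)=\frac{\partial f}{\partial x}(x(t),u(t))\,z(t)+\frac{\partial f}{\partial u}(x(t),u(t))\,v(t)$$ is controllable on $[0,1]$, i.e. for all $z_0,z_1\in\mathbb{R}^n$ there is $v\in\mathcal V$ whose solution with $z(0)=z_0$ satisfies $z(1)=z_1$. Then the end-point map $G_{x_0}:u\mapsto\varphi_1(u,x_0)$ (with the value $0$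 at any $u$ whose solution does not exist on all of $[0,1]$) is a $C^\infty$ submersion at every $u\in U(x_0,y)$, that is, in suitable smooth charts around $u$ and $G_{x_0}(u)$ it is a linear projection onto a direct factor; and $U(x_0,y)$ is a smooth Banach submanifold of $\mathcal V$ of finite codimension $m$: around every $u\in U(x_0,y)$ there is a $C^\infty$ diffeomorphism $\psi$ from an open neighbourhood $O$ of $u$ in $\mathcal V$ onto an open subset of $\mathcal V$, and a closed complemented linear subspace $F\subset\mathcal V$ of codimension $m$, such that $\psi(O\cap U(x_0,y))=\psi(O)\cap F$. (If $U(x_0,y)$ is empty, both conclusions are vacuous.) -/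

import Mathlib

open scoped ContDiff Manifold

namespace NeuralODE

/-- The Euclidean space `ℝ^n`. -/
abbrev Euc (n : ℕ) : Type := EuclideanSpace ℝ (Fin n)

/-- The Banach space `L^∞([0,1], ℝ^p)` of controls. -/
abbrev ControlSpace (p : ℕ) : Type :=
  MeasureTheory.Lp (Euc p) ⊤
    (MeasureTheory.volume.restrict (Set.Icc (0 : ℝ) 1))

/-- `x` is a (Carathéodory) solution on `[0,1]` of `ẋ(t) = g (t, x(t))`, `x(0) = x₀`: the right-hand
side is integrable along `x` and `x` satisfies the integral equation; in particular `x` is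
absolutely continuous on `[0,1]`. Values of `x` outside `[0,1]` are irrelevant. -/
def IsSolution {n : ℕ} (g : ℝ → Euc n → Euc n) (x₀ : Euc n) (x : ℝ → Euc n) : Prop :=
  IntervalIntegrable (fun s => g s (x s)) MeasureTheory.volume 0 1 ∧
    ∀ t ∈ Set.Icc (0 : ℝ) 1, x t = x₀ + ∫ s in (0 : ℝ)..t, g s (x s)

/-- `x` is the trajectory `t ↦ φ_t(u, x₀)` on `[0,1]` of the control system `ẋ = f (x, u)`. -/
def IsTrajectory {n p : ℕ} (f : Euc n → Euc p → Euc n) (u : ControlSpace p) (x₀ : Euc n)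
    (x : ℝ → Euc n) : Prop :=
  IsSolution (fun t ξ => f ξ (u t)) x₀ x

/-- The end-point map `u ↦ φ_1(u, x₀)`. For smooth `f` trajectories are unique on `[0,1]`, so the
choice does not matter; the value is `0` at controls whose trajectory blows up before time `1`. -/
noncomputable def endPointMap {n p : ℕ} (f : Euc n → Euc p → Euc n) (x₀ : Euc n)
    (u : ControlSpace p) : Euc n :=
  open Classical in
  if h : ∃ x : ℝ → Euc n, IsTrajectory f u x₀ x then h.choose 1 else 0

/-- The set `U(x₀, y)` of controls whose trajectory from `x₀` exists on `[0,1]` and ends in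
`R⁻¹(y)`. -/
def controlSet {n p m : ℕ} (f : Euc n → Euc p → Euc n) (R : Euc n →L[ℝ] Euc m) (x₀ : Euc n)
    (y : Euc m) : Set (ControlSpace p) :=
  {u | ∃ x : ℝ → Euc n, IsTrajectory f u x₀ x ∧ R (x 1) = y}

/-- The linear time-varying system `ż = A(t) z + B(t) v` is controllable on `[0,1]`: every state
can be steered to every state by a control in `L^∞`. -/
def IsControllableLTV {n p : ℕ} (A : ℝ → Euc n →L[ℝ] Euc n) (B : ℝ → Euc p →L[ℝ] Euc n) : Prop :=
  ∀ z₀ z₁ : Euc n, ∃ (v : ControlSpace p) (z : ℝ → Euc n),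
    IsSolution (fun t ζ => A t ζ + B t (v t)) z₀ z ∧ z 1 = z₁

/-- The linearized controllability property at `x₀` (with target `y`): for every control in
`U(x₀, y)`, the linearization of `ẋ = f (x, u)` along its trajectory from `x₀` is controllable. -/
def HasLCP {n p m : ℕ} (f : Euc n → Euc p → Euc n) (R : Euc n →L[ℝ] Euc m) (x₀ : Euc n)
    (y : Euc m) : Prop :=
  ∀ u ∈ controlSet f R x₀ y, ∀ x : ℝ → Euc n, IsTrajectory f u x₀ x →
    IsControllableLTV (fun t => fderiv ℝ (fun ξ => f ξ (u t)) (x t))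
      (fun t => fderiv ℝ (fun w => f (x t) w) (u t))

/-- `M` is a smooth (embedded) Banach submanifold of the Banach space `V` of codimension `k`: around
each of its points there is a smooth chart of `V` (a smooth diffeomorphism between open subsets of
`V`) in which `M` becomes a closed, complemented linear subspace `F` of codimension `k`. -/
def IsBanachSubmanifold {V : Type*} [NormedAddCommGroup V] [NormedSpace ℝ V] (M : Set V)
    (k : ℕ) : Prop :=
  ∀ a ∈ M, ∃ (ψ : OpenPartialHomeomorph V V) (F : Submodule ℝ V),
    a ∈ ψ.source ∧ ContDiffOn ℝ ∞ ψ ψ.source ∧ ContDiffOn ℝ ∞ ψ.symm ψ.target ∧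
    IsClosed (F : Set V) ∧ F.ClosedComplemented ∧
    Module.Finite ℝ (V ⧸ F) ∧ Module.finrank ℝ (V ⧸ F) = k ∧
    ∀ v ∈ ψ.source, (v ∈ M ↔ ψ v ∈ F)

end NeuralODE

/-! A trajectory is encoded by its velocity `ξ` in `L^∞`: the pair `(u, ξ)` comes from a trajectory
exactly when `defect g x₀ (u, ξ) = ξ - g(x₀ + ∫ξ, u)` vanishes. This map is smooth because
superposition with a smooth function is smooth on `L^∞` (`contDiff_superposition`). Its partial
derivative in `ξ` is the identity minus a Volterra operator, hence invertible
(`isUnit_one_sub_of_volterra`). The implicit function theorem then gives a velocity `σ v` depending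
smoothly on the control `v` near `u`. So existence on `[0,1]` is an open condition, and by
uniqueness of trajectories the end-point map is locally `x₀ + ∫₀¹ σ v`, which is smooth.

Differentiating `defect = 0` gives the linearized system with zero initial state, so controllability
makes the derivative of the end-point map surjective (`surjective_fderiv_endPointMap`). Since the
target is finite-dimensional, the kernel is complemented, and the inverse function theorem yields
charts in which the map is a projection (`exists_chart_of_surjective_fderiv`). In the same charts,
after a translation, the control set is the kernel of a linear surjection onto `ℝ^m`. -/

namespace NeuralODE

open MeasureTheory Filter Topology

/-! ### Smoothness of superposition operators on `L^∞`. -/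

section Superposition

variable {α : Type} [MeasurableSpace α] {μ : Measure α}
  {E F : Type} [NormedAddCommGroup E] [NormedSpace ℝ E] [NormedAddCommGroup F] [NormedSpace ℝ F]

omit [NormedSpace ℝ E] in
lemma ae_norm_le_norm_Linfty (w : Lp E ⊤ μ) : ∀ᵐ x ∂μ, ‖w x‖ ≤ ‖w‖ := by
  filter_upwards [enorm_ae_le_eLpNormEssSup w μ] with x hx
  rw [Lp.norm_def, eLpNorm_exponent_top, ← toReal_enorm]
  refine ENNReal.toReal_mono ?_ hx
  rw [← eLpNorm_exponent_top]
  exact Lp.eLpNorm_ne_top w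

omit [NormedSpace ℝ E] in
lemma norm_Linfty_le_of_ae_le {w : Lp E ⊤ μ} {c : ℝ} (hc : 0 ≤ c) (h : ∀ᵐ x ∂μ, ‖w x‖ ≤ c) :
    ‖w‖ ≤ c := by
  rw [Lp.norm_def, eLpNorm_exponent_top]
  exact ENNReal.toReal_le_of_le_ofReal hc (eLpNormEssSup_le_of_ae_bound h)

variable [FiniteDimensional ℝ E]

omit [NormedSpace ℝ F] in
lemma memLp_top_continuousMap_comp (g : C(E, F)) (w : Lp E ⊤ μ) :
    MemLp (fun x => g (w x)) ⊤ μ := by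
  obtain ⟨c, hc⟩ := (isCompact_closedBall (0 : E) ‖w‖).exists_bound_of_continuousOn
    g.continuous.continuousOn
  refine memLp_top_of_bound (g.continuous.comp_aestronglyMeasurable (Lp.aestronglyMeasurable w)) c ?_
  filter_upwards [ae_norm_le_norm_Linfty w] with x hx
  exact hc _ (by simpa using hx)

/-- The superposition (Nemytskii) operator `w ↦ g ∘ w` on `L^∞`. -/
noncomputable def superposition (μ : Measure α) (g : C(E, F)) (w : Lp E ⊤ μ) : Lp F ⊤ μ :=
  (memLp_top_continuousMap_comp g w).toLp

omit [NormedSpace ℝ F] in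
lemma coeFn_superposition (g : C(E, F)) (w : Lp E ⊤ μ) :
    superposition μ g w =ᵐ[μ] fun x => g (w x) :=
  MemLp.coeFn_toLp _

-- Almost all values of `w` and of any `v` within distance `1` lie in one closed ball; it is compact
-- since `E` is finite-dimensional, so `g` is uniformly continuous there.
omit [NormedSpace ℝ F] in
lemma continuous_superposition (g : C(E, F)) : Continuous (superposition μ g) := by
  rw [Metric.continuous_iff]
  intro w ε hε
  have huc := (isCompact_closedBall (0 : E) (‖w‖ + 1)).uniformContinuousOn_of_continuous
    g.continuous.continuousOn
  obtain ⟨δ, hδ, H⟩ := Metric.uniformContinuousOn_iff.1 huc (ε / 2) (by positivity)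
  refine ⟨min δ 1, by positivity, fun v hv => ?_⟩
  rw [dist_eq_norm] at hv ⊢
  refine lt_of_le_of_lt (norm_Linfty_le_of_ae_le (c := ε / 2) (by positivity) ?_) (by linarith)
  filter_upwards [ae_norm_le_norm_Linfty w, ae_norm_le_norm_Linfty (v - w),
    coeFn_superposition g w, coeFn_superposition g v, Lp.coeFn_sub v w,
    Lp.coeFn_sub (superposition μ g v) (superposition μ g w)] with x h1 h2 h3 h4 h5 h6
  rw [h6, Pi.sub_apply, h3, h4]
  rw [h5, Pi.sub_apply] at h2
  have h7 : ‖v x - w x‖ < min δ 1 := h2.trans_lt hv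
  have h8 : ‖v x‖ ≤ ‖w‖ + 1 := by
    have := norm_le_norm_add_norm_sub' (v x) (w x)
    have := min_le_right δ 1
    linarith
  have := H (v x) (by simpa using h8) (w x) (by simpa using h1.trans (by linarith))
    (by rw [dist_eq_norm]; exact h7.trans_le (min_le_left _ _))
  rw [dist_eq_norm] at this
  exact this.le

/-- Pointwise application of operator-valued functions, as a continuous bilinear map on `L^∞`. -/
noncomputable def applyL (μ : Measure α) (E F : Type) [NormedAddCommGroup E] [NormedSpace ℝ E]
    [NormedAddCommGroup F] [NormedSpace ℝ F] :
    Lp (E →L[ℝ] F) ⊤ μ →L[ℝ] Lp E ⊤ μ →L[ℝ] Lp F ⊤ μ :=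
  (ContinuousLinearMap.id ℝ (E →L[ℝ] F)).holderL μ ⊤ ⊤ ⊤

omit [FiniteDimensional ℝ E] in
lemma coeFn_applyL (A : Lp (E →L[ℝ] F) ⊤ μ) (w : Lp E ⊤ μ) :
    applyL μ E F A w =ᵐ[μ] fun x => A x (w x) :=
  ContinuousLinearMap.coeFn_holder (r := ⊤) (ContinuousLinearMap.id ℝ (E →L[ℝ] F)) A w

/-- A small `L^∞` distance forces `v x` to be close to `w x` for almost every `x`. The mean value
inequality on the segment joining them then bounds the remainder pointwise, with a constant `c`
independent of `x` by uniform continuity of `g'`. -/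
lemma hasFDerivAt_superposition {g : C(E, F)} {g' : C(E, E →L[ℝ] F)}
    (hg : ∀ x, HasFDerivAt g (g' x) x) (w : Lp E ⊤ μ) :
    HasFDerivAt (superposition μ g) (applyL μ E F (superposition μ g' w)) w := by
  rw [hasFDerivAt_iff_isLittleO, Asymptotics.isLittleO_iff]
  intro c hc
  have huc := (isCompact_closedBall (0 : E) (‖w‖ + 1)).uniformContinuousOn_of_continuous
    g'.continuous.continuousOn
  obtain ⟨δ, hδ, H⟩ := Metric.uniformContinuousOn_iff.1 huc c hc
  filter_upwards [Metric.ball_mem_nhds w (show 0 < min δ 1 by positivity)] with v hv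
  rw [Metric.mem_ball, dist_eq_norm] at hv
  refine norm_Linfty_le_of_ae_le (by positivity) ?_
  filter_upwards [ae_norm_le_norm_Linfty w, ae_norm_le_norm_Linfty (v - w),
    coeFn_superposition g w, coeFn_superposition g v, Lp.coeFn_sub v w,
    Lp.coeFn_sub (superposition μ g v) (superposition μ g w),
    Lp.coeFn_sub (superposition μ g v - superposition μ g w)
      (applyL μ E F (superposition μ g' w) (v - w)),
    coeFn_applyL (superposition μ g' w) (v - w), coeFn_superposition g' w]
    with x h1 h2 h3 h4 h5 h6 h7 h8 h9
  rw [h7, Pi.sub_apply, h6, Pi.sub_apply, h3, h4, h8, h9, h5, Pi.sub_apply]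
  rw [h5, Pi.sub_apply] at h2
  have hlt : ‖v x - w x‖ < min δ 1 := h2.trans_lt hv
  have hseg : ∀ z ∈ segment ℝ (w x) (v x), ‖g' z - g' (w x)‖ ≤ c := by
    intro z hz
    have hz1 : ‖z - w x‖ ≤ ‖v x - w x‖ := by
      obtain ⟨θ, hθ, rfl⟩ := segment_eq_image' ℝ (w x) (v x) ▸ hz
      rw [add_sub_cancel_left, norm_smul, Real.norm_of_nonneg hθ.1]
      exact mul_le_of_le_one_left (norm_nonneg _) hθ.2
    have hz2 : ‖z‖ ≤ ‖w‖ + 1 := by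
      have := norm_le_norm_add_norm_sub' z (w x)
      have := min_le_right δ 1
      linarith
    have := H z (by simpa using hz2) (w x) (by simpa using h1.trans (by linarith))
      (by rw [dist_eq_norm]; exact hz1.trans_lt (hlt.trans_le (min_le_left _ _)))
    rw [dist_eq_norm] at this
    exact this.le
  refine ((convex_segment (w x) (v x)).norm_image_sub_le_of_norm_hasFDerivWithin_le'
    (fun z _ => (hg z).hasFDerivWithinAt) hseg (left_mem_segment ℝ _ _)
    (right_mem_segment ℝ _ _)).trans ?_
  gcongr

/-- The derivative is a superposition operator followed by the bounded linear map `applyL`, which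
feeds the induction. The target `F` is quantified inside because `fderiv ℝ g` takes values in `E
→L[ℝ] F`. -/
lemma contDiff_nat_superposition (k : ℕ) :
    ∀ {F : Type} [NormedAddCommGroup F] [NormedSpace ℝ F] (g : C(E, F)), ContDiff ℝ ∞ g →
      ContDiff ℝ k (superposition μ g) := by
  induction k with
  | zero => exact fun g _ => contDiff_zero.2 (continuous_superposition g)
  | succ k ih =>
    intro F _ _ g hg
    have hg' : ContDiff ℝ ∞ (fderiv ℝ g) := hg.fderiv_right (by simp)
    exact contDiff_succ_iff_hasFDerivAt.2
      ⟨fun w => applyL μ E F (superposition μ ⟨fderiv ℝ g, hg'.continuous⟩ w),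
        (applyL μ E F).contDiff.comp (ih ⟨fderiv ℝ g, hg'.continuous⟩ hg'),
        hasFDerivAt_superposition
          fun x => ((hg.differentiable (by simp)) x).hasFDerivAt⟩

lemma contDiff_superposition {g : C(E, F)} (hg : ContDiff ℝ ∞ g) :
    ContDiff ℝ ∞ (superposition μ g) :=
  contDiff_infty.2 fun k => contDiff_nat_superposition k g hg

end Superposition

/-! ### Normal forms for maps with surjective derivative. -/

section Submersion

variable {V F : Type} [NormedAddCommGroup V] [NormedSpace ℝ V] [CompleteSpace V]
  [NormedAddCommGroup F] [NormedSpace ℝ F] [FiniteDimensional ℝ F]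

/-- A continuous linear surjection onto a finite-dimensional space is a linear projection onto a
direct factor. -/
lemma exists_equiv_prod_ker (A : V →L[ℝ] F) (hA : Function.Surjective A) :
    ∃ L : V ≃L[ℝ] F × A.ker, ∀ v, (L v).1 = A v := by
  have := FiniteDimensional.complete ℝ F
  obtain ⟨P, hP⟩ := A.ker_closedComplemented_of_finiteDimensional_range
  exact ⟨A.equivProdOfSurjectiveOfIsCompl P (LinearMap.range_eq_top.2 hA)
    (LinearMap.range_eq_of_proj hP) (LinearMap.isCompl_of_proj hP), fun v => rfl⟩

/-- Local normal form of a smooth map with surjective derivative into a finite-dimensional space. -/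
theorem exists_chart_of_surjective_fderiv {G : V → F} {D : Set V} (hD : IsOpen D)
    (hG : ContDiffOn ℝ ∞ G D) {a : V} (ha : a ∈ D) (hsurj : Function.Surjective (fderiv ℝ G a)) :
    ∃ (K : Submodule ℝ V) (L : V ≃L[ℝ] F × K) (e : OpenPartialHomeomorph V V),
      a ∈ e.source ∧ e.source ⊆ D ∧ ContDiffOn ℝ ∞ e e.source ∧
      ContDiffOn ℝ ∞ e.symm e.target ∧ ∀ v, (L (e v)).1 = G v := by
  obtain ⟨L, hL⟩ := exists_equiv_prod_ker (fderiv ℝ G a) hsurj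
  -- The `F`-coordinate of `L v` is replaced by `G v`; as `L` has first coordinate `fderiv ℝ G a`,
  -- the derivative of `T` at `a` is the identity.
  let T : V → V := fun v => L.symm (G v, (L v).2)
  have hT : ∀ v ∈ D, ContDiffAt ℝ ∞ T v := fun v hv => by
    have := hG.contDiffAt (hD.mem_nhds hv)
    fun_prop
  have hTa : HasFDerivAt T (ContinuousLinearEquiv.refl ℝ V : V →L[ℝ] V) a := by
    have hGa : HasFDerivAt G (fderiv ℝ G a) a :=
      ((hG.contDiffAt (hD.mem_nhds ha)).differentiableAt (by simp)).hasFDerivAt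
    have hLa : HasFDerivAt (fun v => (L v).2)
        ((ContinuousLinearMap.snd ℝ F _).comp (L : V →L[ℝ] F × (fderiv ℝ G a).ker)) a :=
      ((ContinuousLinearMap.snd ℝ F _).comp (L : V →L[ℝ] F × (fderiv ℝ G a).ker)).hasFDerivAt
    refine (L.symm.hasFDerivAt.comp a (hGa.prodMk hLa)).congr_fderiv ?_
    ext v
    have : ((fderiv ℝ G a) v, (L v).2) = L v := by rw [← hL v]
    simp [this]
  let e₀ := (hT a ha).toOpenPartialHomeomorph T hTa (by simp)
  -- The local inverse must be smooth on the whole target, not only at `T a`, so the source is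
  -- shrunk to points where the derivative of `T` is invertible.
  let S : Set V := D ∩ fderiv ℝ T ⁻¹' Set.range ((↑) : (V ≃L[ℝ] V) → V →L[ℝ] V)
  have hS : IsOpen S :=
    ContinuousOn.isOpen_inter_preimage
      (ContDiffOn.continuousOn_fderiv_of_isOpen
        (fun v hv => (hT v hv).contDiffWithinAt : ContDiffOn ℝ ∞ T D) hD (by simp))
      hD ContinuousLinearEquiv.isOpen
  have haS : a ∈ S := ⟨ha, by rw [Set.mem_preimage, hTa.fderiv]; exact Set.mem_range_self _⟩
  have hsrc : ∀ v ∈ (e₀.restrOpen S hS).source, v ∈ S := fun v hv => by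
    rw [OpenPartialHomeomorph.restrOpen_source] at hv
    exact hv.2
  refine ⟨_, L, e₀.restrOpen S hS, ?_, fun v hv => (hsrc v hv).1,
    fun v hv => (hT v (hsrc v hv).1).contDiffWithinAt, fun w hw => ?_, fun v => ?_⟩
  · rw [OpenPartialHomeomorph.restrOpen_source]
    exact ⟨(hT a ha).mem_toOpenPartialHomeomorph_source hTa (by simp), haS⟩
  · have hv := hsrc _ ((e₀.restrOpen S hS).map_target hw)
    obtain ⟨A, hA⟩ := hv.2
    refine (OpenPartialHomeomorph.contDiffAt_symm _ hw (f₀' := A) ?_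
      (hT _ hv.1)).contDiffWithinAt
    rw [hA]
    exact ((hT _ hv.1).differentiableAt (by simp)).hasFDerivAt
  · change (L (L.symm (G v, (L v).2))).1 = G v
    rw [L.apply_symm_apply]

theorem isSubmersionAt_of_surjective_fderiv {G : V → F} {D : Set V} (hD : IsOpen D)
    (hG : ContDiffOn ℝ ∞ G D) {a : V} (ha : a ∈ D) (hsurj : Function.Surjective (fderiv ℝ G a)) :
    Manifold.IsSubmersionAt 𝓘(ℝ, V) 𝓘(ℝ, F) ∞ G a := by
  obtain ⟨K, L, e, hae, -, he, he', hLe⟩ := exists_chart_of_surjective_fderiv hD hG ha hsurj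
  refine Manifold.IsSubmersionAt.mk_of_charts L e (OpenPartialHomeomorph.refl F) hae
    (Set.mem_univ _) ?_ (contDiffGroupoid ∞ 𝓘(ℝ, F)).id_mem_maximalAtlas (fun _ _ => Set.mem_univ _) ?_
  · refine StructureGroupoid.mem_maximalAtlas_of_mem_groupoid _ ?_
    rw [contDiffGroupoid, mem_groupoid_of_pregroupoid]
    simpa [contDiffPregroupoid] using ⟨he, he'⟩
  · intro w hw
    have hw' : w ∈ e.target := by simpa using hw
    simp [← hLe, e.right_inv hw']

theorem isBanachSubmanifold_of_surjective_fderiv {m : ℕ} {G : V → F} {D : Set V} (hD : IsOpen D)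
    (hG : ContDiffOn ℝ ∞ G D) (R : F →L[ℝ] Euc m) (hR : Function.Surjective R) (y : Euc m)
    {M : Set V} (hM : ∀ v, v ∈ M ↔ v ∈ D ∧ R (G v) = y)
    (hsurj : ∀ v ∈ M, Function.Surjective (fderiv ℝ G v)) :
    IsBanachSubmanifold M m := by
  intro a ha
  obtain ⟨haD, hay⟩ := (hM a).1 ha
  obtain ⟨K, L, e, hae, heD, he, he', hLe⟩ :=
    exists_chart_of_surjective_fderiv hD hG haD (hsurj a ha)
  -- In the chart `e` the map `R ∘ G` becomes the linear map `A` below, and `A c = y`; translating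
  -- by `-c` turns the level set into `A.ker`.
  let c : V := L.symm (G a, 0)
  let A : V →L[ℝ] Euc m :=
    (R.comp (ContinuousLinearMap.fst ℝ F K)).comp (L : V →L[ℝ] F × K)
  have hA : Function.Surjective A := fun z => by
    obtain ⟨w, rfl⟩ := hR z
    exact ⟨L.symm (w, 0), by simp [A]⟩
  let q := LinearMap.quotKerEquivOfSurjective (A : V →ₗ[ℝ] Euc m) hA
  refine ⟨e.transHomeomorph (Homeomorph.addRight (-c)), A.ker, hae, ?_, ?_, A.isClosed_ker,
    A.ker_closedComplemented_of_finiteDimensional_range, Module.Finite.equiv q.symm, ?_, ?_⟩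
  · exact he.add contDiffOn_const
  · exact he'.comp (f := fun v => v + - -c) (s := (fun v => v + - -c) ⁻¹' e.target)
      (contDiff_id.add contDiff_const).contDiffOn fun v hv => hv
  · rw [q.finrank_eq, finrank_euclideanSpace_fin]
  · intro v hv
    have hv' : v ∈ e.source := hv
    have h1 : A (e v + -c) = R (G v) - y := by
      simp [A, c, hLe, hay, sub_eq_add_neg]
    change v ∈ M ↔ A (e v + -c) = 0
    rw [h1, sub_eq_zero, hM, and_iff_right (heD hv')]

end Submersion

/-! ### Integration on `L^∞([0,1])` and Volterra operators. -/

section Volterra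

/-- Lebesgue measure on `[0,1]`. -/
noncomputable abbrev unitMeasure : Measure ℝ := volume.restrict (Set.Icc (0 : ℝ) 1)

variable {E : Type} [NormedAddCommGroup E] [NormedSpace ℝ E]

lemma ae_uIoc_of_ae_unitMeasure {P : ℝ → Prop} (h : ∀ᵐ s ∂unitMeasure, P s) {t : ℝ}
    (ht : t ∈ Set.Icc (0 : ℝ) 1) : ∀ᵐ s, s ∈ Set.uIoc 0 t → P s := by
  rw [ae_restrict_iff' measurableSet_Icc] at h
  filter_upwards [h] with s hs hst
  rw [Set.uIoc_of_le ht.1] at hst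
  exact hs ⟨hst.1.le, hst.2.trans ht.2⟩

lemma integral_congr_of_ae_unitMeasure {g h : ℝ → E} (hgh : g =ᵐ[unitMeasure] h) {t : ℝ}
    (ht : t ∈ Set.Icc (0 : ℝ) 1) : ∫ s in (0 : ℝ)..t, g s = ∫ s in (0 : ℝ)..t, h s :=
  intervalIntegral.integral_congr_ae (ae_uIoc_of_ae_unitMeasure hgh ht)

omit [NormedSpace ℝ E] in
lemma intervalIntegrable_of_integrable_unitMeasure {g : ℝ → E} (hg : Integrable g unitMeasure)
    {t : ℝ} (ht : t ∈ Set.Icc (0 : ℝ) 1) : IntervalIntegrable g volume 0 t := by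
  rw [intervalIntegrable_iff, Set.uIoc_of_le ht.1]
  exact IntegrableOn.mono_set hg fun s hs => ⟨hs.1.le, hs.2.trans ht.2⟩

omit [NormedSpace ℝ E] in
lemma intervalIntegrable_Linfty (ξ : Lp E ⊤ unitMeasure) {t : ℝ} (ht : t ∈ Set.Icc (0 : ℝ) 1) :
    IntervalIntegrable ξ volume 0 t :=
  intervalIntegrable_of_integrable_unitMeasure ((Lp.memLp ξ).integrable le_top) ht

lemma continuousOn_primitive_unit {g : ℝ → E} (hg : IntervalIntegrable g volume 0 1) :
    ContinuousOn (fun t => ∫ s in (0 : ℝ)..t, g s) (Set.Icc 0 1) := by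
  have := intervalIntegral.continuousOn_primitive_interval' hg Set.left_mem_uIcc
  rwa [Set.uIcc_of_le zero_le_one] at this

lemma norm_integral_le_of_ae_le_pow {g : ℝ → E} {c : ℝ} (k : ℕ)
    (h : ∀ᵐ s ∂unitMeasure, ‖g s‖ ≤ c * (s ^ k / k.factorial)) {t : ℝ}
    (ht : t ∈ Set.Icc (0 : ℝ) 1) :
    ‖∫ s in (0 : ℝ)..t, g s‖ ≤ c * (t ^ (k + 1) / (k + 1).factorial) := by
  have h1 := ae_uIoc_of_ae_unitMeasure h ht
  rw [Set.uIoc_of_le ht.1] at h1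
  refine (intervalIntegral.norm_integral_le_of_norm_le ht.1 h1
    (Continuous.intervalIntegrable (by fun_prop) _ _)).trans_eq ?_
  rw [intervalIntegral.integral_const_mul, intervalIntegral.integral_div, integral_pow,
    Nat.factorial_succ]
  push_cast
  field_simp
  simp

/-- A Grönwall argument: iterating the integral inequality gives `‖d t‖ ≤ c (C t)^k / k!` for every
`k`, and the right side tends to `0`. -/
lemma eq_zero_of_norm_le_volterra {d g : ℝ → E} {c C : ℝ}
    (hd : ∀ t ∈ Set.Icc (0 : ℝ) 1, d t = ∫ s in (0 : ℝ)..t, g s)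
    (hc : ∀ t ∈ Set.Icc (0 : ℝ) 1, ‖d t‖ ≤ c) (hC : 0 ≤ C)
    (hg : ∀ᵐ s ∂unitMeasure, ‖g s‖ ≤ C * ‖d s‖) {t : ℝ} (ht : t ∈ Set.Icc (0 : ℝ) 1) :
    d t = 0 := by
  have key : ∀ k : ℕ, ∀ t ∈ Set.Icc (0 : ℝ) 1, ‖d t‖ ≤ c * C ^ k * (t ^ k / k.factorial) := by
    intro k
    induction k with
    | zero => simpa using hc
    | succ k ih =>
      intro t ht
      rw [hd t ht]
      refine norm_integral_le_of_ae_le_pow k ?_ ht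
      filter_upwards [hg, ae_restrict_mem measurableSet_Icc] with s h1 h2
      calc ‖g s‖ ≤ C * ‖d s‖ := h1
        _ ≤ C * (c * C ^ k * (s ^ k / k.factorial)) := by gcongr; exact ih s h2
        _ = c * C ^ (k + 1) * (s ^ k / k.factorial) := by ring
  have hlim : Tendsto (fun k : ℕ => c * ((C * t) ^ k / k.factorial)) atTop (𝓝 (c * 0)) :=
    (FloorSemiring.tendsto_pow_div_factorial_atTop (C * t)).const_mul c
  rw [mul_zero] at hlim
  refine norm_le_zero_iff.1 (ge_of_tendsto' hlim fun k => (key k t ht).trans_eq ?_)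
  rw [mul_pow]
  ring

lemma norm_primitive_le (ξ : Lp E ⊤ unitMeasure) {t : ℝ} (ht : t ∈ Set.Icc (0 : ℝ) 1) :
    ‖∫ s in (0 : ℝ)..t, ξ s‖ ≤ ‖ξ‖ := by
  refine (norm_integral_le_of_ae_le_pow (c := ‖ξ‖) 0 ?_ ht).trans ?_
  · simpa using ae_norm_le_norm_Linfty ξ
  · simpa using mul_le_of_le_one_right (norm_nonneg ξ) ht.2

lemma memLp_top_primitive (ξ : Lp E ⊤ unitMeasure) :
    MemLp (fun t => ∫ s in (0 : ℝ)..t, ξ s) ⊤ unitMeasure := by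
  refine memLp_top_of_bound ((continuousOn_primitive_unit
    (intervalIntegrable_Linfty ξ (by simp))).aestronglyMeasurable measurableSet_Icc) ‖ξ‖ ?_
  filter_upwards [ae_restrict_mem measurableSet_Icc] with t ht using norm_primitive_le ξ ht

lemma primitive_add (ξ η : Lp E ⊤ unitMeasure) {t : ℝ} (ht : t ∈ Set.Icc (0 : ℝ) 1) :
    ∫ s in (0 : ℝ)..t, (ξ + η : Lp E ⊤ unitMeasure) s =
      (∫ s in (0 : ℝ)..t, ξ s) + ∫ s in (0 : ℝ)..t, η s := by
  rw [integral_congr_of_ae_unitMeasure (Lp.coeFn_add ξ η) ht]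
  exact intervalIntegral.integral_add (intervalIntegrable_Linfty ξ ht)
    (intervalIntegrable_Linfty η ht)

lemma primitive_smul (r : ℝ) (ξ : Lp E ⊤ unitMeasure) {t : ℝ} (ht : t ∈ Set.Icc (0 : ℝ) 1) :
    ∫ s in (0 : ℝ)..t, (r • ξ : Lp E ⊤ unitMeasure) s = r • ∫ s in (0 : ℝ)..t, ξ s := by
  rw [integral_congr_of_ae_unitMeasure (Lp.coeFn_smul r ξ) ht]
  exact intervalIntegral.integral_smul r _

variable (E) in
/-- The primitive `ξ ↦ (t ↦ ∫₀ᵗ ξ)` as a continuous linear operator on `L^∞([0,1], E)`. -/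
noncomputable def primitiveL : Lp E ⊤ unitMeasure →L[ℝ] Lp E ⊤ unitMeasure :=
  LinearMap.mkContinuous
    { toFun := fun ξ => (memLp_top_primitive ξ).toLp
      map_add' := fun ξ η => by
        rw [← MemLp.toLp_add]
        refine MemLp.toLp_congr _ _ ?_
        filter_upwards [ae_restrict_mem measurableSet_Icc] with t ht using primitive_add ξ η ht
      map_smul' := fun r ξ => by
        rw [RingHom.id_apply, ← MemLp.toLp_const_smul]
        refine MemLp.toLp_congr _ _ ?_
        filter_upwards [ae_restrict_mem measurableSet_Icc] with t ht using primitive_smul r ξ ht }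
    1 fun ξ => by
      rw [one_mul]
      refine norm_Linfty_le_of_ae_le (norm_nonneg _) ?_
      filter_upwards [ae_restrict_mem measurableSet_Icc, (memLp_top_primitive ξ).coeFn_toLp]
        with t ht h
      exact h ▸ norm_primitive_le ξ ht

lemma coeFn_primitiveL (ξ : Lp E ⊤ unitMeasure) :
    primitiveL E ξ =ᵐ[unitMeasure] fun t => ∫ s in (0 : ℝ)..t, ξ s :=
  (memLp_top_primitive ξ).coeFn_toLp

variable (E) in
/-- The total integral over `[0,1]` as a continuous linear map on `L^∞([0,1], E)`. -/
noncomputable def totalIntegralL : Lp E ⊤ unitMeasure →L[ℝ] E :=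
  LinearMap.mkContinuous
    { toFun := fun ξ => ∫ s in (0 : ℝ)..1, ξ s
      map_add' := fun ξ η => primitive_add ξ η (by simp)
      map_smul' := fun r ξ => primitive_smul r ξ (by simp) }
    1 fun ξ => by
      rw [one_mul]
      exact norm_primitive_le ξ (by simp)

lemma totalIntegralL_apply (ξ : Lp E ⊤ unitMeasure) :
    totalIntegralL E ξ = ∫ s in (0 : ℝ)..1, ξ s := rfl

/-- `1 - K` is invertible for an operator `K` on `L^∞([0,1], E)` of Volterra type. -/
lemma isUnit_one_sub_of_volterra [CompleteSpace E]
    {K : Lp E ⊤ unitMeasure →L[ℝ] Lp E ⊤ unitMeasure} {C : ℝ} (hC : 0 ≤ C)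
    (hK : ∀ ξ : Lp E ⊤ unitMeasure, ∀ᵐ t ∂unitMeasure, ‖K ξ t‖ ≤ C * ‖∫ s in (0 : ℝ)..t, ξ s‖) :
    IsUnit (1 - K) := by
  have key : ∀ (k : ℕ) (ξ : Lp E ⊤ unitMeasure),
      ∀ᵐ t ∂unitMeasure, ‖(K ^ k) ξ t‖ ≤ ‖ξ‖ * C ^ k * (t ^ k / k.factorial) := by
    intro k ξ
    induction k with
    | zero => simpa using ae_norm_le_norm_Linfty ξ
    | succ k ih =>
      filter_upwards [hK ((K ^ k) ξ), ae_restrict_mem measurableSet_Icc] with t h1 h2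
      rw [pow_succ' K k]
      calc ‖K ((K ^ k) ξ) t‖ ≤ C * ‖∫ s in (0 : ℝ)..t, (K ^ k) ξ s‖ := h1
        _ ≤ C * (‖ξ‖ * C ^ k * (t ^ (k + 1) / (k + 1).factorial)) := by
          gcongr
          exact norm_integral_le_of_ae_le_pow k ih h2
        _ = ‖ξ‖ * C ^ (k + 1) * (t ^ (k + 1) / (k + 1).factorial) := by ring
  have hnorm : ∀ k : ℕ, ‖K ^ k‖ ≤ C ^ k / k.factorial := by
    intro k
    refine ContinuousLinearMap.opNorm_le_bound _ (by positivity) fun ξ =>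
      norm_Linfty_le_of_ae_le (by positivity) ?_
    filter_upwards [key k ξ, ae_restrict_mem measurableSet_Icc] with t h1 h2
    calc ‖(K ^ k) ξ t‖ ≤ ‖ξ‖ * C ^ k * (t ^ k / k.factorial) := h1
      _ ≤ ‖ξ‖ * C ^ k * (1 / k.factorial) := by gcongr; exact pow_le_one₀ h2.1 h2.2
      _ = C ^ k / k.factorial * ‖ξ‖ := by ring
  obtain ⟨k, hk⟩ := ((FloorSemiring.tendsto_pow_div_factorial_atTop C).eventually_lt_const
    one_pos).exists
  have hu : IsUnit (1 - K ^ k) := isUnit_one_sub_of_norm_lt_one ((hnorm k).trans_lt hk)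
  -- `K` itself need not be small, but some `1 - K ^ k` is a unit, and `1 - K` divides it with a
  -- commuting cofactor.
  rw [← mul_neg_geom_sum K k] at hu
  refine ((Commute.isUnit_mul_iff ?_).1 hu).1
  exact Commute.sum_right _ _ _ fun i _ =>
    (Commute.one_left _).sub_left ((Commute.refl K).pow_right i)

end Volterra

/-! ### Trajectories as zeros of the defect, and their uniqueness. -/

section Trajectories

lemma IsSolution.continuousOn {n : ℕ} {g : ℝ → Euc n → Euc n} {x₀ : Euc n} {x : ℝ → Euc n}
    (h : IsSolution g x₀ x) : ContinuousOn x (Set.Icc 0 1) :=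
  (continuousOn_const.add (continuousOn_primitive_unit h.1)).congr h.2

variable {n p : ℕ}

lemma memLp_top_of_continuousOn {E : Type} [NormedAddCommGroup E] {x : ℝ → E}
    (hx : ContinuousOn x (Set.Icc 0 1)) : MemLp x ⊤ unitMeasure := by
  obtain ⟨c, hc⟩ := isCompact_Icc.exists_bound_of_continuousOn hx
  refine memLp_top_of_bound (hx.aestronglyMeasurable measurableSet_Icc) c ?_
  filter_upwards [ae_restrict_mem measurableSet_Icc] with t ht using hc t ht

/-- The pairing of a state function and a control as an element of `L^∞([0,1], ℝⁿ × ℝᵖ)`. -/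
noncomputable def pairL (n p : ℕ) :
    Lp (Euc n) ⊤ unitMeasure × ControlSpace p →L[ℝ] Lp (Euc n × Euc p) ⊤ unitMeasure :=
  ((ContinuousLinearMap.inl ℝ (Euc n) (Euc p)).compLpL ⊤ unitMeasure).coprod
    ((ContinuousLinearMap.inr ℝ (Euc n) (Euc p)).compLpL ⊤ unitMeasure)

lemma coeFn_pairL (q : Lp (Euc n) ⊤ unitMeasure × ControlSpace p) :
    pairL n p q =ᵐ[unitMeasure] fun s => (q.1 s, q.2 s) := by
  filter_upwards [(ContinuousLinearMap.inl ℝ (Euc n) (Euc p)).coeFn_compLpL (p := ⊤) q.1,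
    (ContinuousLinearMap.inr ℝ (Euc n) (Euc p)).coeFn_compLpL (p := ⊤) q.2,
    Lp.coeFn_add ((ContinuousLinearMap.inl ℝ (Euc n) (Euc p)).compLpL ⊤ unitMeasure q.1)
      ((ContinuousLinearMap.inr ℝ (Euc n) (Euc p)).compLpL ⊤ unitMeasure q.2)] with s h1 h2 h3
  change ((ContinuousLinearMap.inl ℝ (Euc n) (Euc p)).compLpL ⊤ unitMeasure q.1 +
    (ContinuousLinearMap.inr ℝ (Euc n) (Euc p)).compLpL ⊤ unitMeasure q.2 : Lp _ _ _) s = _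
  rw [h3, Pi.add_apply, h1, h2]
  simp

/-- The pair `(x, u)` of the primitive `x` of a velocity `ξ` with a control `u`. -/
noncomputable def primitivePairL (n p : ℕ) :
    ControlSpace p × Lp (Euc n) ⊤ unitMeasure →L[ℝ] Lp (Euc n × Euc p) ⊤ unitMeasure :=
  (pairL n p).comp (((primitiveL (Euc n)).comp (ContinuousLinearMap.snd ℝ _ _)).prod
    (ContinuousLinearMap.fst ℝ _ _))

lemma coeFn_primitivePairL (q : ControlSpace p × Lp (Euc n) ⊤ unitMeasure) :
    primitivePairL n p q =ᵐ[unitMeasure] fun s => (∫ r in (0 : ℝ)..s, q.2 r, q.1 s) := by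
  filter_upwards [coeFn_pairL (primitiveL (Euc n) q.2, q.1), coeFn_primitiveL q.2] with s h1 h2
  change pairL n p (primitiveL (Euc n) q.2, q.1) s = _
  rw [h1, h2]

/-- The state-control pair with initial state `x₀`, velocity `ξ` and control `u`. -/
noncomputable def stateControl (x₀ : Euc n) (q : ControlSpace p × Lp (Euc n) ⊤ unitMeasure) :
    Lp (Euc n × Euc p) ⊤ unitMeasure :=
  Lp.const ⊤ unitMeasure (x₀, 0) + primitivePairL n p q

lemma coeFn_stateControl (x₀ : Euc n) (q : ControlSpace p × Lp (Euc n) ⊤ unitMeasure) :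
    stateControl x₀ q =ᵐ[unitMeasure] fun s => (x₀ + ∫ r in (0 : ℝ)..s, q.2 r, q.1 s) := by
  filter_upwards [coeFn_primitivePairL q,
    Lp.coeFn_const (p := ⊤) (μ := unitMeasure) ((x₀, 0) : Euc n × Euc p),
    Lp.coeFn_add (Lp.const ⊤ unitMeasure ((x₀, 0) : Euc n × Euc p)) (primitivePairL n p q)]
    with s h1 h2 h3
  rw [stateControl, h3, Pi.add_apply, h1, h2]
  simp

variable (g : C(Euc n × Euc p, Euc n))

/-- The defect `ξ - g(x₀ + ∫ξ, u)` of a velocity `ξ`; it vanishes when `x₀ + ∫ξ` is the trajectory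
of `u`. -/
noncomputable def defect (x₀ : Euc n) (q : ControlSpace p × Lp (Euc n) ⊤ unitMeasure) :
    Lp (Euc n) ⊤ unitMeasure :=
  q.2 - superposition unitMeasure g (stateControl x₀ q)

variable {g}

lemma defect_eq_zero_iff {x₀ : Euc n} {u : ControlSpace p} {ξ : Lp (Euc n) ⊤ unitMeasure} :
    defect g x₀ (u, ξ) = 0 ↔
      ξ =ᵐ[unitMeasure] fun s => g (x₀ + ∫ r in (0 : ℝ)..s, ξ r, u s) := by
  have h : superposition unitMeasure g (stateControl x₀ (u, ξ)) =ᵐ[unitMeasure]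
      fun s => g (x₀ + ∫ r in (0 : ℝ)..s, ξ r, u s) := by
    filter_upwards [coeFn_superposition g (stateControl x₀ (u, ξ)), coeFn_stateControl x₀ (u, ξ)]
      with s h1 h2
    rw [h1, h2]
  rw [defect, sub_eq_zero]
  exact ⟨fun e => (Lp.ext_iff.1 e).trans h, fun e => Lp.ext (e.trans h.symm)⟩

lemma isTrajectory_of_defect_eq_zero {x₀ : Euc n} {u : ControlSpace p}
    {ξ : Lp (Euc n) ⊤ unitMeasure} (h : defect g x₀ (u, ξ) = 0) :
    IsTrajectory (fun a b => g (a, b)) u x₀ (fun t => x₀ + ∫ r in (0 : ℝ)..t, ξ r) := by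
  have h' := defect_eq_zero_iff.1 h
  have hint : Integrable (fun s => g (x₀ + ∫ r in (0 : ℝ)..s, ξ r, u s)) unitMeasure :=
    ((Lp.memLp ξ).integrable le_top).congr h'
  exact ⟨intervalIntegrable_of_integrable_unitMeasure hint (by simp),
    fun t ht => congrArg (x₀ + ·) (integral_congr_of_ae_unitMeasure h' ht)⟩

/-- The velocity is `g(x, u)`. Integrability alone is assumed of it, but it is essentially bounded
because `x` is continuous on `[0,1]` and `u` is in `L^∞`. -/
lemma exists_defect_eq_zero {x₀ : Euc n} {u : ControlSpace p} {x : ℝ → Euc n}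
    (h : IsTrajectory (fun a b => g (a, b)) u x₀ x) :
    ∃ ξ : Lp (Euc n) ⊤ unitMeasure, defect g x₀ (u, ξ) = 0 ∧
      ∀ t ∈ Set.Icc (0 : ℝ) 1, x t = x₀ + ∫ r in (0 : ℝ)..t, ξ r := by
  have hx := memLp_top_of_continuousOn h.continuousOn
  let ξ := superposition unitMeasure g (pairL n p (hx.toLp, u))
  have hξ : ξ =ᵐ[unitMeasure] fun s => g (x s, u s) := by
    filter_upwards [coeFn_superposition g (pairL n p (hx.toLp, u)), coeFn_pairL (hx.toLp, u),
      hx.coeFn_toLp] with s h1 h2 h3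
    rw [h1, h2, h3]
  have hxξ : ∀ t ∈ Set.Icc (0 : ℝ) 1, x t = x₀ + ∫ r in (0 : ℝ)..t, ξ r := fun t ht => by
    rw [integral_congr_of_ae_unitMeasure hξ ht]
    exact h.2 t ht
  refine ⟨ξ, defect_eq_zero_iff.2 ?_, hxξ⟩
  filter_upwards [hξ, ae_restrict_mem measurableSet_Icc] with s h1 h2
  rw [h1, hxξ s h2]

/-- Both trajectories, paired with `u`, stay in a ball on which `g` is Lipschitz, so their
difference obeys a Volterra inequality. -/
lemma IsTrajectory.eqOn (hg : ContDiff ℝ ∞ g) {x₀ : Euc n} {u : ControlSpace p}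
    {x z : ℝ → Euc n} (hx : IsTrajectory (fun a b => g (a, b)) u x₀ x)
    (hz : IsTrajectory (fun a b => g (a, b)) u x₀ z) {t : ℝ} (ht : t ∈ Set.Icc (0 : ℝ) 1) :
    x t = z t := by
  obtain ⟨c₁, hc₁⟩ := isCompact_Icc.exists_bound_of_continuousOn hx.continuousOn
  obtain ⟨c₂, hc₂⟩ := isCompact_Icc.exists_bound_of_continuousOn hz.continuousOn
  let r := max (max c₁ c₂) ‖u‖
  obtain ⟨C, hC⟩ := (hg.contDiffOn (s := Metric.closedBall 0 r)).exists_lipschitzOnWith (by simp)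
    (convex_closedBall 0 r) (isCompact_closedBall 0 r)
  refine sub_eq_zero.1 (eq_zero_of_norm_le_volterra (d := fun t => x t - z t)
    (g := fun s => g (x s, u s) - g (z s, u s)) (c := c₁ + c₂) (C := C) (fun t ht => ?_)
    (fun t ht => (norm_sub_le _ _).trans (add_le_add (hc₁ t ht) (hc₂ t ht))) C.2 ?_ ht)
  · have hsub : Set.uIcc 0 t ⊆ Set.uIcc (0 : ℝ) 1 := by
      rw [Set.uIcc_of_le ht.1, Set.uIcc_of_le zero_le_one]
      exact Set.Icc_subset_Icc_right ht.2
    rw [intervalIntegral.integral_sub (hx.1.mono_set hsub) (hz.1.mono_set hsub), hx.2 t ht,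
      hz.2 t ht, add_sub_add_left_eq_sub]
  · filter_upwards [ae_norm_le_norm_Linfty u, ae_restrict_mem measurableSet_Icc] with s h1 h2
    have hmem : ∀ a : Euc n, ‖a‖ ≤ max c₁ c₂ → (a, u s) ∈ Metric.closedBall 0 r := fun a ha => by
      rw [mem_closedBall_zero_iff, Prod.norm_mk]
      exact max_le_max ha h1
    refine (hC.norm_sub_le (hmem _ ((hc₁ s h2).trans (le_max_left _ _)))
      (hmem _ ((hc₂ s h2).trans (le_max_right _ _)))).trans_eq ?_
    simp [Prod.norm_def]

lemma endPointMap_eq (hg : ContDiff ℝ ∞ g) {x₀ : Euc n} {u : ControlSpace p}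
    {x : ℝ → Euc n} (hx : IsTrajectory (fun a b => g (a, b)) u x₀ x) :
    endPointMap (fun a b => g (a, b)) x₀ u = x 1 := by
  have h : ∃ x : ℝ → Euc n, IsTrajectory (fun a b => g (a, b)) u x₀ x := ⟨x, hx⟩
  rw [endPointMap, dif_pos h]
  exact IsTrajectory.eqOn hg h.choose_spec hx (by simp)

end Trajectories

/-! ### Smoothness of the end-point map and surjectivity of its derivative. -/

section EndPointMap

variable {n p : ℕ} {g : C(Euc n × Euc p, Euc n)}

lemma contDiff_defect (hg : ContDiff ℝ ∞ g) (x₀ : Euc n) : ContDiff ℝ ∞ (defect g x₀) :=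
  contDiff_snd.sub ((contDiff_superposition hg).comp
    (contDiff_const.add (primitivePairL n p).contDiff))

lemma hasFDerivAt_defect {g' : C(Euc n × Euc p, Euc n × Euc p →L[ℝ] Euc n)}
    (hg : ∀ a, HasFDerivAt g (g' a) a) (x₀ : Euc n)
    (q : ControlSpace p × Lp (Euc n) ⊤ unitMeasure) :
    HasFDerivAt (defect g x₀) (ContinuousLinearMap.snd ℝ _ _ -
      (applyL unitMeasure _ _ (superposition unitMeasure g' (stateControl x₀ q))).comp
        (primitivePairL n p)) q :=
  hasFDerivAt_snd.sub ((hasFDerivAt_superposition hg (stateControl x₀ q)).comp q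
    ((primitivePairL n p).hasFDerivAt.const_add (Lp.const ⊤ unitMeasure (x₀, 0))))

/-- The partial derivative is `1 - K`, where `K` takes the primitive and then applies an essentially
bounded operator-valued function; this is of Volterra type. -/
lemma isInvertible_fderiv_defect_inr (hg : ContDiff ℝ ∞ g) (x₀ : Euc n)
    (q : ControlSpace p × Lp (Euc n) ⊤ unitMeasure) :
    (fderiv ℝ (defect g x₀) q ∘L
      ContinuousLinearMap.inr ℝ (ControlSpace p) (Lp (Euc n) ⊤ unitMeasure)).IsInvertible := by
  let g' : C(Euc n × Euc p, Euc n × Euc p →L[ℝ] Euc n) :=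
    ⟨fderiv ℝ g, hg.continuous_fderiv (by simp)⟩
  have hg' : ∀ a, HasFDerivAt g (g' a) a := fun a => (hg.differentiable (by simp) a).hasFDerivAt
  let B := superposition unitMeasure g' (stateControl x₀ q)
  let K : Lp (Euc n) ⊤ unitMeasure →L[ℝ] Lp (Euc n) ⊤ unitMeasure :=
    (applyL unitMeasure _ _ B).comp ((primitivePairL n p).comp (ContinuousLinearMap.inr ℝ _ _))
  have hK : fderiv ℝ (defect g x₀) q ∘L
      ContinuousLinearMap.inr ℝ (ControlSpace p) (Lp (Euc n) ⊤ unitMeasure) = 1 - K := by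
    rw [(hasFDerivAt_defect hg' x₀ q).fderiv]
    rfl
  rw [hK]
  have hu : IsUnit (1 - K) := by
    refine isUnit_one_sub_of_volterra (norm_nonneg B) fun ξ => ?_
    filter_upwards [coeFn_applyL B (primitivePairL n p (0, ξ)), coeFn_primitivePairL (0, ξ),
      Lp.coeFn_zero (Euc p) ⊤ unitMeasure, ae_norm_le_norm_Linfty B] with t h1 h2 h3 h4
    change ‖applyL unitMeasure _ _ B (primitivePairL n p (0, ξ)) t‖ ≤ _
    rw [h1, h2]
    refine ((B t).le_opNorm _).trans (mul_le_mul h4 ?_ (norm_nonneg _) (norm_nonneg _))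
    rw [Prod.norm_mk]
    change max _ ‖(0 : ControlSpace p) t‖ ≤ _
    rw [h3]
    simp
  obtain ⟨U, hU⟩ := hu
  exact ⟨ContinuousLinearEquiv.ofUnit U, by rw [← hU]; rfl⟩

/-- Near a control with a trajectory, the velocity depends smoothly on the control. -/
lemma exists_smooth_velocity (hg : ContDiff ℝ ∞ g) {x₀ : Euc n} {u : ControlSpace p}
    {ξ : Lp (Euc n) ⊤ unitMeasure} (h : defect g x₀ (u, ξ) = 0) :
    ∃ σ : ControlSpace p → Lp (Euc n) ⊤ unitMeasure, ContDiffAt ℝ ∞ σ u ∧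
      (∀ᶠ v in 𝓝 u, defect g x₀ (v, σ v) = 0) ∧
      ∀ v η, fderiv ℝ (defect g x₀) (u, ξ) (v, η) = 0 → fderiv ℝ σ u v = η := by
  have cdf : ContDiffAt ℝ ∞ (defect g x₀) (u, ξ) := (contDiff_defect hg x₀).contDiffAt
  have inv := isInvertible_fderiv_defect_inr hg x₀ (u, ξ)
  refine ⟨cdf.implicitFunction (by simp) inv, cdf.contDiffAt_implicitFunction (by simp) inv,
    h ▸ cdf.eventually_apply_implicitFunction (by simp) inv, fun v η hvη => ?_⟩
  rw [(cdf.hasStrictFDerivAt_implicitFunction (by simp) inv).hasFDerivAt.fderiv]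
  -- The implicit derivative is minus the inverse `ξ`-partial applied to the `u`-partial; the kernel
  -- condition on `(v, η)` makes this equal to `η`.
  have hsplit : fderiv ℝ (defect g x₀) (u, ξ) (v, 0) = -fderiv ℝ (defect g x₀) (u, ξ) (0, η) := by
    rw [eq_neg_iff_add_eq_zero, ← map_add]
    simpa using hvη
  have := inv.inverse_apply_self η
  simp only [ContinuousLinearMap.comp_apply, ContinuousLinearMap.inl_apply,
    ContinuousLinearMap.inr_apply, neg_apply] at this ⊢
  rw [hsplit, map_neg, neg_neg, this]

lemma endPointMap_local (hg : ContDiff ℝ ∞ g) {x₀ : Euc n} {u : ControlSpace p}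
    {σ : ControlSpace p → Lp (Euc n) ⊤ unitMeasure}
    (hσ : ∀ᶠ v in 𝓝 u, defect g x₀ (v, σ v) = 0) :
    endPointMap (fun a b => g (a, b)) x₀ =ᶠ[𝓝 u] fun v => x₀ + totalIntegralL (Euc n) (σ v) := by
  filter_upwards [hσ] with v hv using endPointMap_eq hg (isTrajectory_of_defect_eq_zero hv)

lemma isOpen_exists_isTrajectory (hg : ContDiff ℝ ∞ g) (x₀ : Euc n) :
    IsOpen {u : ControlSpace p | ∃ x, IsTrajectory (fun a b => g (a, b)) u x₀ x} := by
  rw [isOpen_iff_mem_nhds]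
  rintro u ⟨x, hx⟩
  obtain ⟨ξ, hξ, -⟩ := exists_defect_eq_zero hx
  obtain ⟨σ, -, hσ, -⟩ := exists_smooth_velocity hg hξ
  filter_upwards [hσ] with v hv using ⟨_, isTrajectory_of_defect_eq_zero hv⟩

lemma contDiffOn_endPointMap (hg : ContDiff ℝ ∞ g) (x₀ : Euc n) :
    ContDiffOn ℝ ∞ (endPointMap (fun a b => g (a, b)) x₀)
      {u : ControlSpace p | ∃ x, IsTrajectory (fun a b => g (a, b)) u x₀ x} := by
  rintro u ⟨x, hx⟩
  obtain ⟨ξ, hξ, -⟩ := exists_defect_eq_zero hx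
  obtain ⟨σ, hσd, hσ, -⟩ := exists_smooth_velocity hg hξ
  exact ((contDiffAt_const.add ((totalIntegralL (Euc n)).contDiff.contDiffAt.comp u
    hσd)).congr_of_eventuallyEq (endPointMap_local hg hσ)).contDiffWithinAt

/-- Controllability of the linearization makes the derivative of the end-point map surjective. -/
lemma surjective_fderiv_endPointMap (hg : ContDiff ℝ ∞ g) {x₀ : Euc n} {u : ControlSpace p}
    {x : ℝ → Euc n} (hx : IsTrajectory (fun a b => g (a, b)) u x₀ x)
    (hc : IsControllableLTV (fun t => fderiv ℝ (fun a => g (a, u t)) (x t))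
      (fun t => fderiv ℝ (fun b => g (x t, b)) (u t))) :
    Function.Surjective (fderiv ℝ (endPointMap (fun a b => g (a, b)) x₀) u) := by
  intro z₁
  obtain ⟨ξ, hξ, hxξ⟩ := exists_defect_eq_zero hx
  obtain ⟨σ, hσd, hσ, hσ'⟩ := exists_smooth_velocity hg hξ
  -- The initial state `x₀` is fixed, so variations of the trajectory start at `0`.
  obtain ⟨v, z, hz, rfl⟩ := hc 0 z₁
  let g' : C(Euc n × Euc p, Euc n × Euc p →L[ℝ] Euc n) :=
    ⟨fderiv ℝ g, hg.continuous_fderiv (by simp)⟩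
  have hg' : ∀ a, HasFDerivAt g (g' a) a := fun a => (hg.differentiable (by simp) a).hasFDerivAt
  let B := superposition unitMeasure g' (stateControl x₀ (u, ξ))
  have hzLp := memLp_top_of_continuousOn hz.continuousOn
  -- This is the velocity of `z`, so that `(v, η)` lies in the kernel of the derivative of the
  -- defect.
  let η := applyL unitMeasure _ _ B (pairL n p (hzLp.toLp, v))
  have hη : η =ᵐ[unitMeasure] fun t => fderiv ℝ (fun a => g (a, u t)) (x t) (z t) +
      fderiv ℝ (fun b => g (x t, b)) (u t) (v t) := by
    filter_upwards [coeFn_applyL B (pairL n p (hzLp.toLp, v)), coeFn_pairL (hzLp.toLp, v),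
      hzLp.coeFn_toLp, coeFn_superposition g' (stateControl x₀ (u, ξ)),
      coeFn_stateControl x₀ (u, ξ), ae_restrict_mem measurableSet_Icc] with t h1 h2 h3 h4 h5 h6
    rw [h1, h2, h3, h4, h5]
    have hd := hg' (x t, u t)
    have hd1 : fderiv ℝ (fun a => g (a, u t)) (x t) =
        (g' (x t, u t)).comp (ContinuousLinearMap.inl ℝ _ _) :=
      (hd.comp (x t) (hasFDerivAt_prodMk_left (x t) (u t))).fderiv
    have hd2 : fderiv ℝ (fun b => g (x t, b)) (u t) =
        (g' (x t, u t)).comp (ContinuousLinearMap.inr ℝ _ _) :=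
      (hd.comp (u t) (hasFDerivAt_prodMk_right (x t) (u t))).fderiv
    rw [hd1, hd2, ContinuousLinearMap.comp_apply, ContinuousLinearMap.comp_apply, ← map_add,
      ← hxξ t h6]
    simp
  have hzη : ∀ t ∈ Set.Icc (0 : ℝ) 1, z t = ∫ r in (0 : ℝ)..t, η r := fun t ht => by
    rw [integral_congr_of_ae_unitMeasure hη ht, hz.2 t ht, zero_add]
  have hpair : primitivePairL n p (v, η) = pairL n p (hzLp.toLp, v) := by
    refine Lp.ext ?_
    filter_upwards [coeFn_primitivePairL (v, η), coeFn_pairL (hzLp.toLp, v), hzLp.coeFn_toLp,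
      ae_restrict_mem measurableSet_Icc] with t h1 h2 h3 h4
    rw [h1, h2, h3, hzη t h4]
  have hder : fderiv ℝ (defect g x₀) (u, ξ) (v, η) = 0 := by
    rw [(hasFDerivAt_defect hg' x₀ (u, ξ)).fderiv]
    change η - applyL unitMeasure _ _ B (primitivePairL n p (v, η)) = 0
    rw [hpair, sub_self]
  have hG : HasFDerivAt (endPointMap (fun a b => g (a, b)) x₀)
      ((totalIntegralL (Euc n)).comp (fderiv ℝ σ u)) u :=
    (((totalIntegralL (Euc n)).hasFDerivAt.comp u
      (hσd.differentiableAt (by simp)).hasFDerivAt).const_add x₀).congr_of_eventuallyEq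
      (endPointMap_local hg hσ)
  refine ⟨v, ?_⟩
  rw [hG.fderiv, ContinuousLinearMap.comp_apply, hσ' v η hder, totalIntegralL_apply,
    hzη 1 (by simp)]

end EndPointMap

end NeuralODE

theorem mainTheorem2 {n p m : ℕ}
    (f : NeuralODE.Euc n → NeuralODE.Euc p → NeuralODE.Euc n)
    (hf : ContDiff ℝ ∞ (fun q : NeuralODE.Euc n × NeuralODE.Euc p => f q.1 q.2))
    (R : NeuralODE.Euc n →L[ℝ] NeuralODE.Euc m) (hR : Function.Surjective R)
    (x₀ : NeuralODE.Euc n) (y : NeuralODE.Euc m)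
    (hLCP : NeuralODE.HasLCP f R x₀ y) :
    (∀ u ∈ NeuralODE.controlSet f R x₀ y,
      Manifold.IsSubmersionAt 𝓘(ℝ, NeuralODE.ControlSpace p) 𝓘(ℝ, NeuralODE.Euc n) ∞
        (NeuralODE.endPointMap f x₀) u) ∧
    NeuralODE.IsBanachSubmanifold (NeuralODE.controlSet f R x₀ y) m := by
  -- `g (a, b)` unfolds to `f a b`, so results stated for `g` apply to `f` definitionally.
  let g : C(NeuralODE.Euc n × NeuralODE.Euc p, NeuralODE.Euc n) := ⟨_, hf.continuous⟩
  have hg : ContDiff ℝ ∞ g := hf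
  have hD := NeuralODE.isOpen_exists_isTrajectory hg x₀
  have hG := NeuralODE.contDiffOn_endPointMap hg x₀
  have hsurj : ∀ u ∈ NeuralODE.controlSet f R x₀ y,
      Function.Surjective (fderiv ℝ (NeuralODE.endPointMap f x₀) u) := by
    rintro u ⟨x, hx, hy⟩
    exact NeuralODE.surjective_fderiv_endPointMap hg hx (hLCP u ⟨x, hx, hy⟩ x hx)
  refine ⟨fun u hu => ?_, ?_⟩
  · obtain ⟨x, hx, -⟩ := id hu
    exact NeuralODE.isSubmersionAt_of_surjective_fderiv hD hG ⟨x, hx⟩ (hsurj u hu)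
  -- Membership in the domain must accompany the equation `R (G v) = y`: when `y = 0`, the default
  -- value `0` of the end-point map satisfies it as well.
  · refine NeuralODE.isBanachSubmanifold_of_surjective_fderiv hD hG R hR y (fun v => ?_) hsurj
    constructor
    · rintro ⟨x, hx, hy⟩
      exact ⟨⟨x, hx⟩, by rw [NeuralODE.endPointMap_eq hg hx, hy]⟩
    · rintro ⟨⟨x, hx⟩, hy⟩
      exact ⟨x, hx, by rw [← hy, NeuralODE.endPointMap_eq hg hx]⟩
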